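/- **Conventions.** An MV-algebra $(A,\oplus,\odot,\neg,0,1)$ is ordered by $a\le b\iff \neg a\oplus b=1$. An *existential quantifier* on it is a map $\exists:A\to A$ with $\exists 0=0$, $a\le\exists a$, $\exists(a\odot\exists b)=\exists a\odot\exists b$, $\exists(a\oplus\exists b)=\exists a\oplus\exists b$, $\exists(a\odot a)=\exists a\odot\exists a$ and $\exists(a\oplus a)=\exists a\oplus\exists a$. For a set $\alpha$ let $\wp_\omega(\alpha)$ be the set of its finite subsets. Let $G\subseteq{}^\alpha\alpha$ be a semigroup under composition. An algebra in $MV_{G,\wp_\omega(\alpha)}$ is an MV-algebra $A$ with an MV-endomorphism $\mathsf s_\tau$ for each $\tau\in G$ and an existential quantifier $\mathsf c_{(J)}$ for each $J\in\wp_\omega(\alpha)$ such that, for all $p\in A$, $\sigma,\tau\in G$ and $J,J'\in\wp_\omega(\alpha)$: $\mathsf s_{Id}p=p$ (if $Id\in G$); $\mathsf s_{\sigma\circ\tau}p=\mathsf s_\sigma\mathsf s_\tau p$; $\mathsf c_{(\emptyset)}p=p$; $\mathsf c_{(J\cup J')}p=\mathsf c_{(J)}\mathsf c_{(J')}p$;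 $\mathsf s_\sigma\mathsf c_{(J)}p=\mathsf s_\tau\mathsf c_{(J)}p$ whenever $\sigma$ and $\tau$ agree on $\alpha\setminus J$; $\mathsf c_{(J)}\mathsf s_\sigma p=\mathsf s_\sigma\mathsf c_{(\sigma^{-1}(J))}p$ whenever $\sigma$ is injective on $\sigma^{-1}(J)$. A semigroup $G$ of transformations of a countably infinite set $\alpha$ is *strongly rich* if (1) for all $\tau\in G$ and $i,j\in\alpha$, the map $\tau[i|j]$ that sends $i$ to $j$ and agrees with $\tau$ elsewhere is in $G$; and there are $\sigma,\pi\in G$ such that (2) $\pi\circ\sigma=Id$ and $\mathrm{Rg}\,\sigma\ne\alpha$; (3) for each $\tau\in G$, the map that is the identity on $\alpha\setminus\mathrm{Rg}\,\sigma$ and agrees with $\sigma\circ\tau\circ\pi$ on $\mathrm{Rg}\,\sigma$ is in $G$; (4) for each $n\in\omega$ the support $\{i:\sigma^n\pi^n(i)\neq i\}$ of $\sigma^n\circ\pi^n$ is finite and is contained in $\alpha\setminus \mathrm{Rg}(\sigma^n)$. Let $\alpha\subseteq\beta$. For $\tau\in{}^\alpha\alpha$ put $\bar\tau=\tau\cup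 Id_{\beta\setminus\alpha}$. Let $H$ be a semigroup of transformations of $\beta$ with $\bar\tau\in H$ for all $\tau\in G$, and let $\mathfrak B\in MV_{H,\wp_\omega(\beta)}$. Then $\mathfrak{Rd}_\alpha\mathfrak B\in MV_{G,\wp_\omega(\alpha)}$ has the universe and MV-operations of $\mathfrak B$, the $\mathsf c_{(J)}$ with $J\in\wp_\omega(\alpha)$, and the operations $\mathsf s_{\bar\tau}$ in the role of $\mathsf s_\tau$ for $\tau\in G$. With $\Delta x=\{i\in\beta:\mathsf c_{(\{i\})}x\ne x\}$, the neat reduct $\mathfrak{Nr}_\alpha\mathfrak B$ is the subalgebra of $\mathfrak{Rd}_\alpha\mathfrak B$ with universe $\{x\in B:\Delta x\subseteq\alpha\}$, if this set is a subuniverse; likewise for subalgebras of $\mathfrak B$. $\mathfrak{Sg}^{\mathfrak A}X$ is the subalgebra of $\mathfrak A$ generated by $X$. **Theorem.** Let $\alpha\subseteq\beta$ be countably infinite sets, $G$ a strongly rich semigroup on $\alpha$, and $\mathfrak A\in MV_{G,\wp_\omega(\alpha)}$. Then there exist a strongly rich semigroup $H$ on $\beta$ with $\bar\tau\in H$ for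 all $\tau\in G$, and $\mathfrak B\in MV_{H,\wp_\omega(\beta)}$, such that $\mathfrak{Nr}_\alpha\mathfrak B$ exists and, up to an isomorphism of $\mathfrak A$ with a subalgebra, $\mathfrak A\subseteq\mathfrak{Nr}_\alpha\mathfrak B$ and for all $X\subseteq A$ $$\mathfrak{Sg}^{\mathfrak A}X=\mathfrak{Nr}_\alpha\mathfrak{Sg}^{\mathfrak B}X .$$ If $G$ and $A$ are countable, then $H$ and $B$ can be chosen countable. -/

import Mathlib

universe u v

namespace MVPolyadic

/-- MV-algebras `(A, ⊕, ⊙, ¬, 0, 1)`. -/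
class MVAlgebra (A : Type u) where
  oplus : A → A → A
  odot : A → A → A
  neg : A → A
  zero : A
  one : A
  oplus_comm : ∀ a b, oplus a b = oplus b a
  odot_comm : ∀ a b, odot a b = odot b a
  oplus_assoc : ∀ a b c, oplus a (oplus b c) = oplus (oplus a b) c
  odot_assoc : ∀ a b c, odot a (odot b c) = odot (odot a b) c
  oplus_zero : ∀ a, oplus a zero = a
  odot_one : ∀ a, odot a one = a
  oplus_one : ∀ a, oplus a one = one
  odot_zero : ∀ a, odot a zero = zero
  oplus_neg : ∀ a, oplus a (neg a) = one
  odot_neg : ∀ a, odot a (neg a) = zero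
  neg_oplus : ∀ a b, neg (oplus a b) = odot (neg a) (neg b)
  neg_odot : ∀ a b, neg (odot a b) = oplus (neg a) (neg b)
  neg_neg : ∀ a, neg (neg a) = a
  neg_zero : neg zero = one
  lukasiewicz : ∀ a b,
    oplus (neg (oplus (neg a) b)) b = oplus (neg (oplus (neg b) a)) a

namespace MVAlgebra

/-- The natural (lattice) order of an MV-algebra: `a ≤ b` iff `¬a ⊕ b = 1`. -/
def le {A : Type u} [MVAlgebra A] (a b : A) : Prop := oplus (neg a) b = one

/-- Homomorphisms of MV-algebras. -/
structure IsHom {A B : Type u} [MVAlgebra A] [MVAlgebra B] (f : A → B) : Prop where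
  map_oplus : ∀ a b, f (oplus a b) = oplus (f a) (f b)
  map_odot : ∀ a b, f (odot a b) = odot (f a) (f b)
  map_neg : ∀ a, f (neg a) = neg (f a)
  map_zero : f zero = zero
  map_one : f one = one

/-- Existential quantifiers on an MV-algebra. -/
structure IsExistentialQuantifier {A : Type u} [MVAlgebra A] (E : A → A) : Prop where
  map_zero : E zero = zero
  le_apply : ∀ a, le a (E a)
  odot_apply : ∀ a b, E (odot a (E b)) = odot (E a) (E b)
  oplus_apply : ∀ a b, E (oplus a (E b)) = oplus (E a) (E b)
  odot_self : ∀ a, E (odot a a) = odot (E a) (E a)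
  oplus_self : ∀ a, E (oplus a a) = oplus (E a) (E a)

end MVAlgebra

open MVAlgebra

open Classical in
/-- A polyadic MV-algebra of type `(G, ℘_ω(I))` on the universe `A`: the dimension is the set `I`,
`G` is a semigroup of transformations of `I` under composition, there is a substitution operator
`s τ` for every `τ ∈ G` and a cylindrifier `c J` for every finite `J ⊆ I`. -/
structure PolyadicMV {I : Type v} (G : Subsemigroup (Function.End I)) (A : Type u)
    [MVAlgebra A] where
  s : G → A → A
  c : Finset I → A → A
  s_isHom : ∀ τ, IsHom (s τ)
  c_quantifier : ∀ J, IsExistentialQuantifier (c J)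
  s_id : ∀ h : (1 : Function.End I) ∈ G, ∀ p, s ⟨1, h⟩ p = p
  s_comp : ∀ σ τ : G, ∀ p, s (σ * τ) p = s σ (s τ p)
  c_empty : ∀ p, c ∅ p = p
  c_union : ∀ J J' p, c (J ∪ J') p = c J (c J' p)
  s_c_congr : ∀ (σ τ : G) (J : Finset I),
    (∀ i, i ∉ J → σ.1 i = τ.1 i) → ∀ p, s σ (c J p) = s τ (c J p)
  /-- Here `K = σ⁻¹(J)`, which is finite because `σ` is injective on it. -/
  c_s : ∀ (σ : G) (J K : Finset I), (K : Set I) = σ.1 ⁻¹' (J : Set I) →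
    Set.InjOn σ.1 (K : Set I) → ∀ p, c J (s σ p) = s σ (c K p)

/-! ### Rich semigroups -/

open Classical in
/-- `f[H|g]`: the function that agrees with `g` on `H` and with `f` elsewhere. -/
noncomputable def patch {I : Type v} (f : I → I) (H : Set I) (g : I → I) : Function.End I :=
  fun i => if i ∈ H then g i else f i

/-- The support of a transformation. -/
def supp {I : Type v} (f : I → I) : Set I := {i | f i ≠ i}

/-- Closure under changing the value at one point: `τ[i|j] ∈ T` for all `τ ∈ T`. -/
def ClosedUnderReplacement {I : Type v} (T : Subsemigroup (Function.End I)) : Prop :=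
  ∀ i j, ∀ τ ∈ T, patch τ {i} (fun _ => j) ∈ T

/-- The pair `σ, π` witnesses richness of `T`. -/
structure IsRichPair {I : Type v} (T : Subsemigroup (Function.End I))
    (σ π : Function.End I) : Prop where
  left_mem : σ ∈ T
  right_mem : π ∈ T
  comp_eq_id : π ∘ σ = id
  range_ne : Set.range σ ≠ Set.univ
  patch_mem : ∀ τ ∈ T, patch (σ ∘ τ ∘ π) (Set.range σ)ᶜ id ∈ T

/-- Strongly rich semigroups: rich ones (the first two conjuncts), with a witnessing pair that
satisfies the two conditions on supports. The notion is used on a countably infinite set `I` (so that `|supp| < |I|` says that the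
support is finite). -/
def IsStronglyRich {I : Type v} (T : Subsemigroup (Function.End I)) : Prop :=
  ClosedUnderReplacement T ∧ ∃ σ π, IsRichPair T σ π ∧
    (∀ n : ℕ, (supp (σ^[n] ∘ π^[n])).Finite) ∧
    (∀ n : ℕ, supp (σ^[n] ∘ π^[n]) ⊆ (Set.range σ^[n])ᶜ)

/-! ### Reducts, subalgebras and neat reducts -/

open Classical in
/-- `τ̄ = τ ∪ Id_{β ∖ α}`, the extension of a transformation of `α` by the identity. -/
noncomputable def extendId {β : Type v} {α : Set β} (τ : Function.End α) : Function.End β :=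
  fun b => if h : b ∈ α then (τ ⟨b, h⟩ : β) else b

section extend

variable {β : Type v} {α : Set β}

theorem extendId_of_mem (τ : Function.End α) {b : β} (h : b ∈ α) :
    extendId τ b = (τ ⟨b, h⟩ : β) := by
  simp [extendId, h]

theorem extendId_of_notMem (τ : Function.End α) {b : β} (h : b ∉ α) :
    extendId τ b = b := by
  simp [extendId, h]

theorem extendId_one : extendId (1 : Function.End α) = 1 := by
  funext b
  by_cases h : b ∈ α
  · rw [extendId_of_mem _ h]; rfl
  · rw [extendId_of_notMem _ h]; rfl

theorem extendId_mul (σ τ : Function.End α) :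
    extendId (σ * τ) = extendId σ * extendId τ := by
  funext b
  change extendId (σ * τ) b = extendId σ (extendId τ b)
  by_cases h : b ∈ α
  · rw [extendId_of_mem _ h, extendId_of_mem τ h, extendId_of_mem σ (τ ⟨b, h⟩).2]; rfl
  · rw [extendId_of_notMem _ h, extendId_of_notMem τ h, extendId_of_notMem σ h]

end extend

namespace PolyadicMV

/-- The reduct `Rd_α 𝔅`: the operations `c J` for finite `J ⊆ α` and `s τ̄` for `τ ∈ G`. -/
noncomputable def reduct {β : Type v} {α : Set β} {G : Subsemigroup (Function.End α)}
    {H : Subsemigroup (Function.End β)} {B : Type u} [MVAlgebra B] (𝔅 : PolyadicMV H B)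
    (hGH : ∀ τ ∈ G, extendId τ ∈ H) : PolyadicMV G B where
  s τ := 𝔅.s ⟨extendId τ.1, hGH τ.1 τ.2⟩
  c J := 𝔅.c (J.map (Function.Embedding.subtype _))
  s_isHom τ := 𝔅.s_isHom _
  c_quantifier J := 𝔅.c_quantifier _
  s_id h p := by
    have h1 : (1 : Function.End β) ∈ H := by
      have := hGH _ h
      rwa [extendId_one] at this
    have h2 : (⟨extendId (1 : Function.End α), hGH _ h⟩ : H) = ⟨1, h1⟩ :=
      Subtype.ext extendId_one
    change 𝔅.s ⟨extendId (1 : Function.End α), hGH _ h⟩ p = p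
    rw [h2]
    exact 𝔅.s_id h1 p
  s_comp σ τ p := by
    rw [← 𝔅.s_comp]
    congr 2
    exact extendId_mul _ _
  c_empty p := by simpa using 𝔅.c_empty p
  c_union J J' p := by
    classical
    rw [← 𝔅.c_union, ← Finset.map_union]
    congr!
  s_c_congr σ τ J h p := by
    refine 𝔅.s_c_congr _ _ _ (fun i hi => ?_) p
    by_cases hα : i ∈ α
    · have : (⟨i, hα⟩ : α) ∉ J := fun hJ => hi (Finset.mem_map.2 ⟨⟨i, hα⟩, hJ, rfl⟩)
      simp only [extendId_of_mem _ hα, h _ this]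
    · simp only [extendId_of_notMem _ hα]
  c_s σ J K hK hinj p := by
    have hval : ∀ k : α, extendId σ.1 (k : β) = (σ.1 k : β) := fun k => extendId_of_mem _ k.2
    have hmem : ∀ k : α, k ∈ K ↔ σ.1 k ∈ J := fun k => Set.ext_iff.1 hK k
    refine 𝔅.c_s _ _ _ ?_ ?_ p
    · ext b
      constructor
      · intro hb
        obtain ⟨k, hk, rfl⟩ := Finset.mem_map.1 (Finset.mem_coe.1 hb)
        refine Finset.mem_coe.2 (Finset.mem_map.2 ⟨σ.1 k, (hmem k).1 hk, ?_⟩)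
        exact (hval k).symm
      · intro hb
        obtain ⟨j, hj, hjb⟩ := Finset.mem_map.1 (Finset.mem_coe.1 hb)
        change (j : β) = extendId σ.1 b at hjb
        by_cases hα : b ∈ α
        · have hj' : j = σ.1 ⟨b, hα⟩ := Subtype.ext (hjb.trans (hval ⟨b, hα⟩))
          exact Finset.mem_coe.2 (Finset.mem_map.2 ⟨⟨b, hα⟩, (hmem _).2 (hj' ▸ hj), rfl⟩)
        · rw [extendId_of_notMem _ hα] at hjb
          exact absurd (hjb ▸ j.2) hα
    · intro a' ha' b' hb' hab
      obtain ⟨a, ha, rfl⟩ := Finset.mem_map.1 (Finset.mem_coe.1 ha')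
      obtain ⟨b, hb, rfl⟩ := Finset.mem_map.1 (Finset.mem_coe.1 hb')
      have h1 : (σ.1 a : β) = (σ.1 b : β) := (hval a).symm.trans (hab.trans (hval b))
      exact congrArg _ (hinj ha hb (Subtype.ext h1))

variable {I : Type v} {G : Subsemigroup (Function.End I)} {A : Type u} [MVAlgebra A]

/-- Subuniverses: subsets closed under all operations, including the constants. -/
structure IsSubuniverse (𝔸 : PolyadicMV G A) (S : Set A) : Prop where
  oplus_mem : ∀ a ∈ S, ∀ b ∈ S, oplus a b ∈ S
  odot_mem : ∀ a ∈ S, ∀ b ∈ S, odot a b ∈ S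
  neg_mem : ∀ a ∈ S, neg a ∈ S
  zero_mem : zero ∈ S
  one_mem : one ∈ S
  s_mem : ∀ τ, ∀ a ∈ S, 𝔸.s τ a ∈ S
  c_mem : ∀ J, ∀ a ∈ S, 𝔸.c J a ∈ S

/-- `Sg^𝔸 X`: (the universe of) the subalgebra of `𝔸` generated by `X`. -/
def Sg (𝔸 : PolyadicMV G A) (X : Set A) : Set A :=
  ⋂₀ {S | 𝔸.IsSubuniverse S ∧ X ⊆ S}

/-- Homomorphisms between polyadic MV-algebras of the same type. -/
structure IsHom {B : Type u} [MVAlgebra B] (𝔸 : PolyadicMV G A) (𝔅 : PolyadicMV G B)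
    (f : A → B) : Prop extends MVAlgebra.IsHom f where
  map_s : ∀ τ a, f (𝔸.s τ a) = 𝔅.s τ (f a)
  map_c : ∀ J a, f (𝔸.c J a) = 𝔅.c J (f a)

/-- The dimension set `Δx = {i : c_i x ≠ x}`. -/
def dimSet (𝔸 : PolyadicMV G A) (x : A) : Set I := {i | 𝔸.c {i} x ≠ x}

/-- For a subuniverse `S` of `𝔸`, the universe `{x ∈ S : Δx ⊆ α}` of the `α`-neat reduct of the
subalgebra of `𝔸` with universe `S`; the whole algebra is the case `S = Set.univ`. -/
def Nr (𝔸 : PolyadicMV G A) (α : Set I) (S : Set A) : Set A := {x ∈ S | 𝔸.dimSet x ⊆ α}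

end PolyadicMV

end MVPolyadic

/-! The dilation is cut out of a direct limit. As `σ` is injective but not onto, each passage in α →
α → ⋯ along `σ` leaves a point `d` outside the range. The index set β is realised inside the limit
of this chain: α sits at stage 0, and each element of β ∖ α enters as `d` at a stage of its own
(`Ladder`, `exists_startsAt`).

A transformation of β is admitted into H when some stage represents it by a member of G that is the
identity away from the indices of that stage. Condition (3) of richness says precisely that the
representative at the next stage is again in G (`Good.conj_succ`). In the same way 𝔅 consists of
those elements of the limit of A → A → ⋯ along `s σ` whose dimension set lies in β. They are treated
as threads modulo eventual equality, with coordinatewise operations, so each axiom of 𝔅 is an axiom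
of 𝔸 at late stages.

The embedding sends `a` to the thread of its shifts; it is injective because `s π` inverts `s σ` on
the left. For the neat reduct, let a thread have dimension set inside α. Its value `p` at a late
stage N is then independent of every index outside the range of `σ^N`. The map `σ^N ∘ π^N` moves
only finitely many indices, all outside that range, so `s (σ^N ∘ π^N) p = p`
(`iterate_shift_unshift`). Hence the thread comes from `s (π^N) p` (`eq_embed`), and this element
lies in every subalgebra of 𝔸 containing `p`, which gives the statement on generated subalgebras. -/

namespace MVPolyadic

open MVAlgebra Filter

/-! ### MV-algebras and the fixed points of a quantifier -/

namespace MVAlgebra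

variable {A : Type u} [MVAlgebra A]

theorem neg_one : neg (one : A) = zero := by
  rw [← neg_zero, neg_neg]

theorem zero_oplus (a : A) : oplus zero a = a := by
  rw [oplus_comm, oplus_zero]

theorem eq_of_le_of_le {a b : A} (h₁ : le a b) (h₂ : le b a) : a = b := by
  have h := lukasiewicz a b
  rw [show oplus (neg a) b = one from h₁, show oplus (neg b) a = one from h₂, neg_one,
    zero_oplus, zero_oplus] at h
  exact h.symm

theorem isHom_id : IsHom (id : A → A) := by
  constructor <;> intros <;> rfl

namespace IsExistentialQuantifier

variable {E : A → A} (hE : IsExistentialQuantifier E)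
include hE

theorem apply_one : E one = one := by
  have h : oplus (neg one) (E one) = one := hE.le_apply one
  rwa [neg_one, zero_oplus] at h

theorem fixed_oplus {a b : A} (ha : E a = a) (hb : E b = b) : E (oplus a b) = oplus a b := by
  have h := hE.oplus_apply a b
  rwa [ha, hb] at h

theorem fixed_odot {a b : A} (ha : E a = a) (hb : E b = b) : E (odot a b) = odot a b := by
  have h := hE.odot_apply a b
  rwa [ha, hb] at h

/-- From `¬a ⊙ a = 0` the quantifier law gives `E (¬a) ⊙ a = 0`, that is, `E (¬a) ≤ ¬a`. -/
theorem fixed_neg {a : A} (ha : E a = a) : E (neg a) = neg a := by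
  refine eq_of_le_of_le ?_ (hE.le_apply _)
  have h := hE.odot_apply (neg a) a
  rw [ha, odot_comm (neg a) a, odot_neg, hE.map_zero] at h
  change oplus (neg (E (neg a))) (neg a) = one
  rw [← neg_odot, ← h, neg_zero]

end IsExistentialQuantifier

end MVAlgebra

/-! ### Transformations -/

section Transformations

variable {I : Type v}

open Classical in
/-- Over a semigroup closed under replacement, finitely many values may be changed. -/
theorem ClosedUnderReplacement.patch_mem {T : Subsemigroup (Function.End I)}
    (hT : ClosedUnderReplacement T) {τ : Function.End I} (hτ : τ ∈ T) {D : Set I}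
    (hD : D.Finite) (g : I → I) : patch τ D g ∈ T := by
  induction D, hD using Set.Finite.induction_on with
  | empty =>
    convert hτ using 1
    funext i
    simp [patch]
  | @insert a D _ _ ih =>
    convert hT a (g a) _ ih using 1
    funext i
    by_cases h : i = a <;> simp [patch, h]

theorem IsRichPair.one_mem {T : Subsemigroup (Function.End I)} {σ π : Function.End I}
    (h : IsRichPair T σ π) : (1 : Function.End I) ∈ T := by
  have h' := T.mul_mem h.right_mem h.left_mem
  rwa [show π * σ = 1 from h.comp_eq_id] at h'

theorem IsRichPair.leftInverse {T : Subsemigroup (Function.End I)} {σ π : Function.End I}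
    (h : IsRichPair T σ π) : Function.LeftInverse π σ := congrFun h.comp_eq_id

theorem iterate_mem {T : Subsemigroup (Function.End I)} (h1 : (1 : Function.End I) ∈ T)
    {σ : Function.End I} (hσ : σ ∈ T) (n : ℕ) : (σ^[n] : Function.End I) ∈ T := by
  induction n with
  | zero => exact h1
  | succ n ih => exact T.mul_mem ih hσ

end Transformations

theorem extendId_iterate {β : Type v} {α : Set β} (τ : Function.End α) (n : ℕ) :
    (extendId τ)^[n] = extendId (β := β) (τ^[n] : Function.End α) := by
  induction n with
  | zero => exact extendId_one.symm
  | succ n ih =>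
    refine (congrArg (· ∘ extendId τ) ih).trans ?_
    exact (extendId_mul (τ^[n] : Function.End α) τ).symm

theorem supp_extendId {β : Type v} {α : Set β} (τ : Function.End α) :
    supp (extendId τ) = Subtype.val '' supp τ := by
  ext b
  by_cases hb : b ∈ α
  · simp [supp, extendId_of_mem _ hb, hb, Subtype.ext_iff]
  · simp [supp, extendId_of_notMem _ hb, hb]

/-! ### Elementary facts on polyadic MV-algebras -/

namespace PolyadicMV

variable {I : Type v} {G : Subsemigroup (Function.End I)} {A : Type u} [MVAlgebra A]
  (𝔸 : PolyadicMV G A)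

open Classical in
theorem c_comm (J K : Finset I) (p : A) : 𝔸.c J (𝔸.c K p) = 𝔸.c K (𝔸.c J p) := by
  rw [← 𝔸.c_union, ← 𝔸.c_union, Finset.union_comm]

open Classical in
theorem c_eq_self {J : Finset I} {p : A} (h : ∀ i ∈ J, 𝔸.c {i} p = p) : 𝔸.c J p = p := by
  induction J using Finset.induction_on with
  | empty => exact 𝔸.c_empty p
  | insert a J _ ih =>
    rw [Finset.insert_eq, 𝔸.c_union, ih fun i hi => h i (Finset.mem_insert_of_mem hi)]
    exact h a (Finset.mem_insert_self a J)

theorem c_eq_self_of_commutes {J K : Finset I} {p : A} (h : 𝔸.c J p = p) :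
    𝔸.c J (𝔸.c K p) = 𝔸.c K p := by
  rw [c_comm, h]

theorem c_s_of_iff {τ : G} {J K : Finset I} (h : ∀ k, k ∈ K ↔ τ.1 k ∈ J)
    (hinj : ∀ a ∈ K, ∀ b ∈ K, τ.1 a = τ.1 b → a = b) (p : A) :
    𝔸.c J (𝔸.s τ p) = 𝔸.s τ (𝔸.c K p) :=
  𝔸.c_s τ J K (Set.ext h) (fun a ha b hb hab => hinj a ha b hb hab) p

theorem c_singleton_s {τ : G} {i : I} (hτ : ∀ k, τ.1 k = i ↔ k = i) (p : A) :
    𝔸.c {i} (𝔸.s τ p) = 𝔸.s τ (𝔸.c {i} p) :=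
  𝔸.c_s_of_iff (fun k => by rw [Finset.mem_singleton, Finset.mem_singleton, hτ])
    (fun a ha b hb _ => (Finset.mem_singleton.1 ha).trans (Finset.mem_singleton.1 hb).symm) p

/-- The preimage of `{i}` is empty, so the cylindrifier passes through `s τ` as `c ∅`. -/
theorem c_s_of_notMem_range {τ : G} {i : I} (hi : ∀ k, τ.1 k ≠ i) (p : A) :
    𝔸.c {i} (𝔸.s τ p) = 𝔸.s τ p := by
  refine (𝔸.c_s_of_iff (K := ∅) (fun k => ?_) (by simp) p).trans (by rw [𝔸.c_empty])
  rw [Finset.mem_singleton]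
  simpa using hi k

open Classical in
theorem c_image_s {τ : G} (hτ : Function.Injective τ.1) (J : Finset I) (p : A) :
    𝔸.c (J.image τ.1) (𝔸.s τ p) = 𝔸.s τ (𝔸.c J p) :=
  𝔸.c_s_of_iff (fun _ => (hτ.mem_finset_image).symm) (fun _ _ _ _ h => hτ h) p

theorem iterate_s (h1 : (1 : Function.End I) ∈ G) (σ : G) (n : ℕ) (p : A) :
    (𝔸.s σ)^[n] p = 𝔸.s ⟨σ.1^[n], iterate_mem h1 σ.2 n⟩ p := by
  induction n generalizing p with
  | zero => exact (𝔸.s_id h1 p).symm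
  | succ n ih =>
    rw [Function.iterate_succ_apply, ih, ← 𝔸.s_comp]
    rfl

/-- The operation `s τ`, extended by the identity map to `τ ∉ G`. -/
noncomputable def sTotal (τ : Function.End I) : A → A :=
  open Classical in if h : τ ∈ G then 𝔸.s ⟨τ, h⟩ else id

theorem sTotal_of_mem {τ : Function.End I} (h : τ ∈ G) : 𝔸.sTotal τ = 𝔸.s ⟨τ, h⟩ := dif_pos h

theorem sTotal_isHom (τ : Function.End I) : MVAlgebra.IsHom (𝔸.sTotal τ) := by
  unfold sTotal
  split
  · exact 𝔸.s_isHom _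
  · exact isHom_id

theorem Sg_isSubuniverse (X : Set A) : 𝔸.IsSubuniverse (𝔸.Sg X) where
  oplus_mem a ha b hb S hS := hS.1.oplus_mem a (ha S hS) b (hb S hS)
  odot_mem a ha b hb S hS := hS.1.odot_mem a (ha S hS) b (hb S hS)
  neg_mem a ha S hS := hS.1.neg_mem a (ha S hS)
  zero_mem _ hS := hS.1.zero_mem
  one_mem _ hS := hS.1.one_mem
  s_mem τ a ha S hS := hS.1.s_mem τ a (ha S hS)
  c_mem J a ha S hS := hS.1.c_mem J a (ha S hS)

theorem subset_Sg (X : Set A) : X ⊆ 𝔸.Sg X := fun _ hx _ hS => hS.2 hx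

theorem Sg_subset {X S : Set A} (hS : 𝔸.IsSubuniverse S) (hX : X ⊆ S) : 𝔸.Sg X ⊆ S :=
  fun _ hx => hx S ⟨hS, hX⟩

theorem IsSubuniverse.sTotal_mem {S : Set A} {𝔸 : PolyadicMV G A} (hS : 𝔸.IsSubuniverse S)
    (τ : Function.End I) {a : A} (ha : a ∈ S) : 𝔸.sTotal τ a ∈ S := by
  unfold sTotal
  split
  · exact hS.s_mem _ _ ha
  · exact ha

theorem IsSubuniverse.iterate_mem {S : Set A} {𝔸 : PolyadicMV G A} (hS : 𝔸.IsSubuniverse S)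
    (τ : G) (n : ℕ) {a : A} (ha : a ∈ S) : (𝔸.s τ)^[n] a ∈ S := by
  induction n with
  | zero => exact ha
  | succ n ih =>
    rw [Function.iterate_succ_apply']
    exact hS.s_mem _ _ ih

theorem mem_Nr {𝔸 : PolyadicMV G A} {α : Set I} {S : Set A} {x : A} :
    x ∈ 𝔸.Nr α S ↔ x ∈ S ∧ ∀ i, i ∉ α → 𝔸.c {i} x = x := by
  refine and_congr_right fun _ => forall_congr' fun i => ?_
  exact not_imp_comm

theorem extendId_eq_iff {β : Type v} {α : Set β} (τ : Function.End α) {i : β} (hi : i ∉ α)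
    (k : β) : extendId τ k = i ↔ k = i := by
  by_cases hk : k ∈ α
  · rw [extendId_of_mem _ hk]
    exact ⟨fun h => absurd (h ▸ (τ ⟨k, hk⟩).2) hi, fun h => absurd (h ▸ hk) hi⟩
  · rw [extendId_of_notMem _ hk]

/-- The fixed points of a quantifier are closed under the MV-operations, cylindrifiers commute, and
an index outside α is its own only preimage under `extendId τ`. -/
theorem Nr_univ_isSubuniverse {β : Type v} {α : Set β} {G : Subsemigroup (Function.End α)}
    {H : Subsemigroup (Function.End β)} {B : Type u} [MVAlgebra B] (𝔅 : PolyadicMV H B)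
    (hGH : ∀ τ ∈ G, extendId τ ∈ H) :
    (𝔅.reduct hGH).IsSubuniverse (𝔅.Nr α Set.univ) := by
  constructor <;> simp only [mem_Nr, Set.mem_univ, true_and]
  · exact fun a ha b hb i hi => (𝔅.c_quantifier _).fixed_oplus (ha i hi) (hb i hi)
  · exact fun a ha b hb i hi => (𝔅.c_quantifier _).fixed_odot (ha i hi) (hb i hi)
  · exact fun a ha i hi => (𝔅.c_quantifier _).fixed_neg (ha i hi)
  · exact fun i _ => (𝔅.c_quantifier _).map_zero
  · exact fun i _ => (𝔅.c_quantifier _).apply_one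
  · intro τ a ha i hi
    exact (𝔅.c_singleton_s (extendId_eq_iff τ.1 hi) a).trans (congrArg _ (ha i hi))
  · exact fun J a ha i hi => 𝔅.c_eq_self_of_commutes (ha i hi)

end PolyadicMV

end MVPolyadic

/-! ### Ladders and the semigroup on the larger index set -/

namespace MVPolyadic

open MVAlgebra Filter

theorem patch_of_mem {I : Type v} {f g : I → I} {H : Set I} {i : I} (h : i ∈ H) :
    patch f H g i = g i := by
  simp [patch, h]

theorem patch_of_notMem {I : Type v} {f g : I → I} {H : Set I} {i : I} (h : i ∉ H) :
    patch f H g i = f i := by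
  simp [patch, h]

/-- A description of the index set `β` as a subset of the direct limit of `I → I → ⋯` along `σ`:
the index `b` appears at stage `rank b`, and at stages `n ≥ rank b` it is represented by
`lev n b`. -/
structure Ladder {I : Type v} (G : Subsemigroup (Function.End I)) (β : Type v) where
  σ : Function.End I
  π : Function.End I
  rich : IsRichPair G σ π
  closed : ClosedUnderReplacement G
  rank : β → ℕ
  lev : ℕ → β → I
  lev_succ : ∀ n b, rank b ≤ n → lev (n + 1) b = σ (lev n b)
  lev_inj : ∀ n a b, rank a ≤ n → rank b ≤ n → lev n a = lev n b → a = b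

namespace Ladder

variable {I β : Type v} {G : Subsemigroup (Function.End I)} (L : Ladder G β)

/-- The indices in `I` that represent an element of `β` at stage `n`. -/
def levels (n : ℕ) : Set I := {i | ∃ b, L.rank b ≤ n ∧ L.lev n b = i}

theorem lev_mem {n : ℕ} {b : β} (h : L.rank b ≤ n) : L.lev n b ∈ L.levels n := ⟨b, h, rfl⟩

theorem σ_injective : Function.Injective L.σ := L.rich.leftInverse.injective

theorem lev_add {n : ℕ} {b : β} (h : L.rank b ≤ n) (k : ℕ) :
    L.lev (n + k) b = L.σ^[k] (L.lev n b) := by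
  induction k with
  | zero => rfl
  | succ k ih =>
    refine ((L.lev_succ _ _ (by omega)).trans (congrArg L.σ ih)).trans ?_
    exact (Function.iterate_succ_apply' L.σ k _).symm

open Classical in
/-- The transformation of `I` that acts as `τ` on the indices of stage `n` and as the identity
elsewhere. -/
noncomputable def conj (n : ℕ) (τ : Function.End β) : Function.End I := fun i =>
  if h : i ∈ L.levels n then L.lev n (τ h.choose) else i

theorem conj_lev {n : ℕ} {b : β} (h : L.rank b ≤ n) (τ : Function.End β) :
    L.conj n τ (L.lev n b) = L.lev n (τ b) := by
  have hm := L.lev_mem h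
  have hs := hm.choose_spec
  rw [conj, dif_pos hm, L.lev_inj n _ _ hs.1 h hs.2]

theorem conj_of_notMem {n : ℕ} {i : I} (h : i ∉ L.levels n) (τ : Function.End β) :
    L.conj n τ i = i := dif_neg h

/-- At stage `n` the transformation `τ` of `β` is represented by a member of `G`. -/
structure Good (n : ℕ) (τ : Function.End β) : Prop where
  rank_le : ∀ b, L.rank b ≤ n → L.rank (τ b) ≤ n
  eq_self : ∀ b, n < L.rank b → τ b = b
  mem : L.conj n τ ∈ G

variable {L}

/-- The indices of stage `n` are carried along by `σ`. Any other index of stage `n + 1` represents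
an element of rank `n + 1`, which `τ` fixes, whether or not it lies in the range of `σ`. -/
theorem Good.conj_succ {n : ℕ} {τ : Function.End β} (h : L.Good n τ) :
    L.conj (n + 1) τ = patch (L.σ ∘ L.conj n τ ∘ L.π) (Set.range L.σ)ᶜ id := by
  funext i
  by_cases hi : i ∈ Set.range L.σ
  · obtain ⟨j, rfl⟩ := hi
    refine Eq.trans ?_ (patch_of_notMem (not_not_intro ⟨j, rfl⟩)).symm
    refine Eq.trans ?_ (congrArg (fun k => L.σ (L.conj n τ k)) (L.rich.leftInverse j)).symm
    by_cases hj : j ∈ L.levels n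
    · obtain ⟨b, hb, rfl⟩ := hj
      rw [L.conj_lev hb, ← L.lev_succ _ _ hb, L.conj_lev (by omega),
        L.lev_succ _ _ (h.rank_le b hb)]
    · rw [L.conj_of_notMem hj]
      by_cases hi : L.σ j ∈ L.levels (n + 1)
      · obtain ⟨b, hb, hbj⟩ := hi
        have hb' : n < L.rank b := by
          by_contra! hb'
          rw [L.lev_succ _ _ hb'] at hbj
          exact hj ⟨b, hb', L.σ_injective hbj⟩
        rw [← hbj, L.conj_lev hb, h.eq_self b hb']
      · exact L.conj_of_notMem hi τ
  · refine Eq.trans ?_ (patch_of_mem hi).symm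
    by_cases hi' : i ∈ L.levels (n + 1)
    · obtain ⟨b, hb, rfl⟩ := hi'
      have hb' : n < L.rank b := by
        by_contra! hb'
        exact hi ⟨_, (L.lev_succ _ _ hb').symm⟩
      exact (L.conj_lev hb τ).trans (congrArg _ (h.eq_self b hb'))
    · exact L.conj_of_notMem hi' τ

theorem Good.succ {n : ℕ} {τ : Function.End β} (h : L.Good n τ) : L.Good (n + 1) τ where
  rank_le b hb := by
    rcases Nat.lt_or_ge n (L.rank b) with hb' | hb'
    · rwa [h.eq_self b hb']
    · have := h.rank_le b hb'
      omega
  eq_self b hb := h.eq_self b (by omega)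
  mem := by
    rw [h.conj_succ]
    exact L.rich.patch_mem _ h.mem

theorem Good.mono {m n : ℕ} {τ : Function.End β} (h : L.Good m τ) (hmn : m ≤ n) :
    L.Good n τ := by
  induction n, hmn using Nat.le_induction with
  | base => exact h
  | succ n _ ih => exact ih.succ

theorem Good.conj_mul {n : ℕ} {τ τ' : Function.End β} (h' : L.Good n τ') :
    L.conj n (τ * τ') = L.conj n τ * L.conj n τ' := by
  funext i
  change _ = L.conj n τ (L.conj n τ' i)
  by_cases hi : i ∈ L.levels n
  · obtain ⟨b, hb, rfl⟩ := hi
    rw [L.conj_lev hb, L.conj_lev hb, L.conj_lev (h'.rank_le b hb)]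
    rfl
  · rw [L.conj_of_notMem hi, L.conj_of_notMem hi, L.conj_of_notMem hi]

theorem Good.mul {n : ℕ} {τ τ' : Function.End β} (h : L.Good n τ) (h' : L.Good n τ') :
    L.Good n (τ * τ') where
  rank_le b hb := h.rank_le _ (h'.rank_le b hb)
  eq_self b hb := by
    change τ (τ' b) = b
    rw [h'.eq_self b hb, h.eq_self b hb]
  mem := by
    rw [h'.conj_mul]
    exact G.mul_mem h.mem h'.mem

theorem Good.patch {n : ℕ} {τ : Function.End β} (h : L.Good n τ) {a b : β}
    (ha : L.rank a ≤ n) (hb : L.rank b ≤ n) : L.Good n (patch τ {a} fun _ => b) := by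
  have hne : ∀ c, c ≠ a → MVPolyadic.patch τ {a} (fun _ => b) c = τ c := fun c hc =>
    patch_of_notMem hc
  have heq : MVPolyadic.patch τ {a} (fun _ => b) a = b := patch_of_mem rfl
  refine ⟨fun c hc => ?_, fun c hc => ?_, ?_⟩
  · by_cases hca : c = a
    · rwa [hca, heq]
    · rw [hne c hca]
      exact h.rank_le c hc
  · rw [hne c (by rintro rfl; omega), h.eq_self c hc]
  · convert L.closed (L.lev n a) (L.lev n b) _ h.mem using 1
    funext i
    by_cases hi : i ∈ L.levels n
    · obtain ⟨c, hc, rfl⟩ := hi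
      rw [L.conj_lev hc]
      by_cases hca : c = a
      · rw [hca, heq]
        exact (patch_of_mem (g := fun _ => L.lev n b) (Set.mem_singleton (L.lev n a))).symm
      · rw [hne c hca, ← L.conj_lev hc]
        refine (patch_of_notMem ?_).symm
        exact fun hc' => hca (L.lev_inj n _ _ hc ha hc')
    · refine (L.conj_of_notMem hi _).trans (Eq.trans ?_ (patch_of_notMem ?_).symm)
      · rw [L.conj_of_notMem hi]
      · intro hi'
        exact hi (hi' ▸ L.lev_mem ha)

theorem conj_one (n : ℕ) : L.conj n 1 = 1 := by
  funext i
  by_cases hi : i ∈ L.levels n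
  · obtain ⟨b, hb, rfl⟩ := hi
    exact L.conj_lev hb 1
  · exact L.conj_of_notMem hi 1

theorem conj_eq_iff {n : ℕ} {τ : Function.End β} {i : I} (hi : i ∉ L.levels n)
    (h : L.Good n τ) (k : I) : L.conj n τ k = i ↔ k = i := by
  by_cases hk : k ∈ L.levels n
  · obtain ⟨b, hb, rfl⟩ := hk
    rw [L.conj_lev hb]
    exact ⟨fun e => absurd (e ▸ L.lev_mem (h.rank_le b hb)) hi,
      fun e => absurd (e ▸ L.lev_mem hb) hi⟩
  · rw [L.conj_of_notMem hk]

/-- Each stage contributes no more transformations than G has members; hence the semigroup is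
countable when G is. -/
theorem Good.ext {n : ℕ} {τ τ' : Function.End β} (h : L.Good n τ) (h' : L.Good n τ')
    (heq : L.conj n τ = L.conj n τ') : τ = τ' := by
  funext b
  rcases Nat.lt_or_ge n (L.rank b) with hb | hb
  · rw [h.eq_self b hb, h'.eq_self b hb]
  · refine L.lev_inj n _ _ (h.rank_le b hb) (h'.rank_le b hb) ?_
    rw [← L.conj_lev hb, heq, L.conj_lev hb]

variable (L) in
/-- The semigroup of the transformations of `β` that some stage represents in `G`. -/
def semigroup : Subsemigroup (Function.End β) where
  carrier := {τ | ∃ n, L.Good n τ}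
  mul_mem' := by
    rintro τ τ' ⟨m, h⟩ ⟨n, h'⟩
    exact ⟨max m n, (h.mono (le_max_left _ _)).mul (h'.mono (le_max_right _ _))⟩

theorem eventually_good (τ : L.semigroup) : ∀ᶠ n in atTop, L.Good n τ.1 := by
  obtain ⟨n, h⟩ := τ.2
  filter_upwards [eventually_ge_atTop n] with m hm using h.mono hm

variable (L) in
theorem eventually_rank_le (b : β) : ∀ᶠ n in atTop, L.rank b ≤ n := eventually_ge_atTop _

variable (L) in
theorem eventually_forall_rank_le (J : Finset β) : ∀ᶠ n in atTop, ∀ b ∈ J, L.rank b ≤ n :=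
  (eventually_all_finset J).2 fun b _ => L.eventually_rank_le b

variable (L) in
theorem semigroup_closed : ClosedUnderReplacement L.semigroup := by
  intro a b τ hτ
  obtain ⟨n, h, ha, hb⟩ := ((eventually_good ⟨τ, hτ⟩).and
    ((L.eventually_rank_le a).and (L.eventually_rank_le b))).exists
  exact ⟨n, h.patch ha hb⟩

variable (L) in
theorem semigroup_countable (hG : (G : Set (Function.End I)).Countable) :
    (L.semigroup : Set (Function.End β)).Countable := by
  have h : (L.semigroup : Set (Function.End β)) = ⋃ n, {τ | L.Good n τ} := by
    ext τ
    exact Set.mem_iUnion.symm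
  rw [h]
  refine Set.countable_iUnion fun n => ?_
  exact Set.MapsTo.countable_of_injOn (f := L.conj n) (fun τ h => h.mem)
    (fun τ h τ' h' => h.ext h') hG

open Classical in
theorem image_lev_succ {n : ℕ} {J : Finset β} (hJ : ∀ b ∈ J, L.rank b ≤ n) :
    J.image (L.lev (n + 1)) = (J.image (L.lev n)).image L.σ := by
  exact (Finset.image_congr fun b hb => L.lev_succ n b (hJ b hb)).trans
    Finset.image_image.symm

end Ladder

end MVPolyadic

/-! ### Threads and the dilation -/

namespace MVPolyadic

open MVAlgebra Filter

namespace Ladder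

variable {I β : Type v} {G : Subsemigroup (Function.End I)} (L : Ladder G β)
  {A : Type u} [MVAlgebra A] (𝔸 : PolyadicMV G A)

/-- The component `σ` as a member of `G`. -/
def shift : G := ⟨L.σ, L.rich.left_mem⟩

/-- The component `π` as a member of `G`. -/
def unshift : G := ⟨L.π, L.rich.right_mem⟩

theorem s_shift_leftInverse :
    Function.LeftInverse (𝔸.s L.unshift) (𝔸.s L.shift) := by
  intro a
  have h : L.unshift * L.shift = ⟨1, L.rich.one_mem⟩ := Subtype.ext L.rich.comp_eq_id
  rw [← 𝔸.s_comp, h, 𝔸.s_id]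

/-- A sequence is a thread if it represents an element of the direct limit of `A → A → ⋯` along
`s σ` whose dimension set is contained in `β`. -/
def IsThread (f : ℕ → A) : Prop :=
  ∀ᶠ n in atTop, f (n + 1) = 𝔸.s L.shift (f n) ∧ ∀ i, i ∉ L.levels n → 𝔸.c {i} (f n) = f n

variable {L 𝔸}

namespace IsThread

variable {f g : ℕ → A}

theorem oplus (hf : L.IsThread 𝔸 f) (hg : L.IsThread 𝔸 g) :
    L.IsThread 𝔸 fun n => oplus (f n) (g n) := by
  filter_upwards [hf, hg] with n hf hg
  refine ⟨?_, fun i hi => (𝔸.c_quantifier _).fixed_oplus (hf.2 i hi) (hg.2 i hi)⟩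
  rw [hf.1, hg.1, (𝔸.s_isHom _).map_oplus]

theorem odot (hf : L.IsThread 𝔸 f) (hg : L.IsThread 𝔸 g) :
    L.IsThread 𝔸 fun n => odot (f n) (g n) := by
  filter_upwards [hf, hg] with n hf hg
  refine ⟨?_, fun i hi => (𝔸.c_quantifier _).fixed_odot (hf.2 i hi) (hg.2 i hi)⟩
  rw [hf.1, hg.1, (𝔸.s_isHom _).map_odot]

theorem neg (hf : L.IsThread 𝔸 f) : L.IsThread 𝔸 fun n => neg (f n) := by
  filter_upwards [hf] with n hf
  refine ⟨?_, fun i hi => (𝔸.c_quantifier _).fixed_neg (hf.2 i hi)⟩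
  rw [hf.1, (𝔸.s_isHom _).map_neg]

theorem zero : L.IsThread 𝔸 fun _ => zero :=
  .of_forall fun _ => ⟨(𝔸.s_isHom _).map_zero.symm, fun _ _ => (𝔸.c_quantifier _).map_zero⟩

theorem one : L.IsThread 𝔸 fun _ => one :=
  .of_forall fun _ => ⟨(𝔸.s_isHom _).map_one.symm, fun _ _ => (𝔸.c_quantifier _).apply_one⟩

theorem s (hf : L.IsThread 𝔸 f) (τ : L.semigroup) :
    L.IsThread 𝔸 fun n => 𝔸.sTotal (L.conj n τ.1) (f n) := by
  filter_upwards [hf, eventually_good τ] with n hf hτ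
  refine ⟨?_, fun i hi => ?_⟩
  · rw [𝔸.sTotal_of_mem hτ.mem, 𝔸.sTotal_of_mem hτ.succ.mem, hf.1, ← 𝔸.s_comp, ← 𝔸.s_comp]
    -- The representatives intertwine with the shift: `conj (n + 1) τ ∘ σ = σ ∘ conj n τ`.
    refine congrArg (fun ρ => 𝔸.s ρ (f n)) (Subtype.ext (funext fun i => ?_))
    change L.conj (n + 1) τ.1 (L.σ i) = L.σ (L.conj n τ.1 i)
    rw [hτ.conj_succ]
    refine (patch_of_notMem (not_not_intro ⟨i, rfl⟩)).trans ?_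
    exact congrArg (fun k => L.σ (L.conj n τ k)) (L.rich.leftInverse i)
  · rw [𝔸.sTotal_of_mem hτ.mem]
    exact (𝔸.c_singleton_s (conj_eq_iff hi hτ) _).trans (congrArg _ (hf.2 i hi))

open Classical in
theorem c (hf : L.IsThread 𝔸 f) (J : Finset β) :
    L.IsThread 𝔸 fun n => 𝔸.c (J.image (L.lev n)) (f n) := by
  filter_upwards [hf, L.eventually_forall_rank_le J] with n hf hJ
  refine ⟨?_, fun i hi => 𝔸.c_eq_self_of_commutes (hf.2 i hi)⟩
  rw [hf.1, image_lev_succ hJ]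
  exact 𝔸.c_image_s (τ := L.shift) L.σ_injective _ _

end IsThread

variable (L 𝔸)

/-- Two threads are identified if they agree eventually. -/
instance threadSetoid : Setoid {f : ℕ → A // L.IsThread 𝔸 f} where
  r f g := ∀ᶠ n in atTop, f.1 n = g.1 n
  iseqv := {
    refl := fun _ => .of_forall fun _ => rfl
    symm := fun h => h.mono fun _ => Eq.symm
    trans := fun h h' => by filter_upwards [h, h'] with n using Eq.trans }

/-- The universe of the dilation of `𝔸` along the ladder. -/
def Dilation : Type u := Quotient (L.threadSetoid 𝔸)

variable {L 𝔸}

namespace Dilation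

/-- The class of a thread. -/
def mk (f : ℕ → A) (hf : L.IsThread 𝔸 f) : L.Dilation 𝔸 := Quotient.mk _ ⟨f, hf⟩

theorem ind {P : L.Dilation 𝔸 → Prop} (h : ∀ f hf, P (mk f hf)) (x : L.Dilation 𝔸) : P x :=
  Quotient.ind (fun f => h f.1 f.2) x

theorem mk_eq_mk {f g : ℕ → A} {hf : L.IsThread 𝔸 f} {hg : L.IsThread 𝔸 g} :
    (mk f hf : L.Dilation 𝔸) = mk g hg ↔ ∀ᶠ n in atTop, f n = g n :=
  Quotient.eq (r := L.threadSetoid 𝔸)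

theorem mk_eq_of_forall {f g : ℕ → A} {hf : L.IsThread 𝔸 f} {hg : L.IsThread 𝔸 g}
    (h : ∀ n, f n = g n) : (mk f hf : L.Dilation 𝔸) = mk g hg :=
  mk_eq_mk.2 (.of_forall h)

instance : MVAlgebra (L.Dilation 𝔸) where
  oplus := Quotient.map₂ (fun f g => ⟨_, f.2.oplus g.2⟩) fun _ _ h _ _ h' => by
    filter_upwards [h, h'] with n h h' using congrArg₂ oplus h h'
  odot := Quotient.map₂ (fun f g => ⟨_, f.2.odot g.2⟩) fun _ _ h _ _ h' => by
    filter_upwards [h, h'] with n h h' using congrArg₂ odot h h'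
  neg := Quotient.map (fun f => ⟨_, f.2.neg⟩) fun _ _ h => h.mono fun _ => congrArg neg
  zero := mk _ .zero
  one := mk _ .one
  oplus_comm := ind fun _ _ => ind fun _ _ => mk_eq_of_forall fun _ => oplus_comm _ _
  odot_comm := ind fun _ _ => ind fun _ _ => mk_eq_of_forall fun _ => odot_comm _ _
  oplus_assoc := ind fun _ _ => ind fun _ _ => ind fun _ _ =>
    mk_eq_of_forall fun _ => oplus_assoc _ _ _
  odot_assoc := ind fun _ _ => ind fun _ _ => ind fun _ _ =>
    mk_eq_of_forall fun _ => odot_assoc _ _ _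
  oplus_zero := ind fun _ _ => mk_eq_of_forall fun _ => oplus_zero _
  odot_one := ind fun _ _ => mk_eq_of_forall fun _ => odot_one _
  oplus_one := ind fun _ _ => mk_eq_of_forall fun _ => oplus_one _
  odot_zero := ind fun _ _ => mk_eq_of_forall fun _ => odot_zero _
  oplus_neg := ind fun _ _ => mk_eq_of_forall fun _ => oplus_neg _
  odot_neg := ind fun _ _ => mk_eq_of_forall fun _ => odot_neg _
  neg_oplus := ind fun _ _ => ind fun _ _ => mk_eq_of_forall fun _ => neg_oplus _ _
  neg_odot := ind fun _ _ => ind fun _ _ => mk_eq_of_forall fun _ => neg_odot _ _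
  neg_neg := ind fun _ _ => mk_eq_of_forall fun _ => neg_neg _
  neg_zero := mk_eq_of_forall fun _ => neg_zero
  lukasiewicz := ind fun _ _ => ind fun _ _ => mk_eq_of_forall fun _ => lukasiewicz _ _

/-- Substitutions act on the threads coordinatewise. -/
noncomputable def subst (τ : L.semigroup) : L.Dilation 𝔸 → L.Dilation 𝔸 :=
  Quotient.map (fun f => ⟨_, f.2.s τ⟩) fun _ _ h => h.mono fun _ => congrArg _

open Classical in
/-- Cylindrifiers act on the threads coordinatewise. -/
noncomputable def cyl (J : Finset β) : L.Dilation 𝔸 → L.Dilation 𝔸 :=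
  Quotient.map (fun f => ⟨_, f.2.c J⟩) fun _ _ h => h.mono fun _ => congrArg _

end Dilation

open Ladder.Dilation

open Classical in
-- Indices that represent nothing are fixed by `conj n τ` and so never enter the image of `J`; the
-- preimage of that image is therefore just the image of `K`.
theorem Good.c_s {n : ℕ} {τ : Function.End β} (h : L.Good n τ) {J K : Finset β}
    (hJ : ∀ b ∈ J, L.rank b ≤ n) (hK : ∀ b ∈ K, L.rank b ≤ n) (hJK : ∀ b, b ∈ K ↔ τ b ∈ J)
    (hinj : ∀ a ∈ K, ∀ b ∈ K, τ a = τ b → a = b) (p : A) :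
    𝔸.c (J.image (L.lev n)) (𝔸.s ⟨_, h.mem⟩ p) =
      𝔸.s ⟨_, h.mem⟩ (𝔸.c (K.image (L.lev n)) p) := by
  refine 𝔸.c_s_of_iff (fun i => ?_) (fun i hi j hj hij => ?_) p
  · simp only [Finset.mem_image]
    constructor
    · rintro ⟨b, hb, rfl⟩
      exact ⟨τ b, (hJK b).1 hb, (L.conj_lev (hK b hb) τ).symm⟩
    · rintro ⟨b, hb, hbi⟩
      by_cases hi : i ∈ L.levels n
      · obtain ⟨d, hd, rfl⟩ := hi
        rw [L.conj_lev hd] at hbi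
        have := L.lev_inj n _ _ (hJ b hb) (h.rank_le d hd) hbi
        exact ⟨d, (hJK d).2 (this ▸ hb), rfl⟩
      · rw [L.conj_of_notMem hi] at hbi
        exact absurd (hbi ▸ L.lev_mem (hJ b hb)) hi
  · obtain ⟨a, ha, rfl⟩ := Finset.mem_image.1 hi
    obtain ⟨b, hb, rfl⟩ := Finset.mem_image.1 hj
    change L.conj n τ _ = L.conj n τ _ at hij
    rw [L.conj_lev (hK a ha), L.conj_lev (hK b hb)] at hij
    rw [hinj a ha b hb (L.lev_inj n _ _ (h.rank_le a (hK a ha)) (h.rank_le b (hK b hb)) hij)]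

variable (L 𝔸)

open Classical in
/-- The dilation of `𝔸` along the ladder. -/
noncomputable def dilation : PolyadicMV L.semigroup (L.Dilation 𝔸) where
  s := subst
  c := cyl
  s_isHom τ := {
    map_oplus := ind fun _ _ => ind fun _ _ =>
      mk_eq_of_forall fun _ => (𝔸.sTotal_isHom _).map_oplus _ _
    map_odot := ind fun _ _ => ind fun _ _ =>
      mk_eq_of_forall fun _ => (𝔸.sTotal_isHom _).map_odot _ _
    map_neg := ind fun _ _ => mk_eq_of_forall fun _ => (𝔸.sTotal_isHom _).map_neg _
    map_zero := mk_eq_of_forall fun _ => (𝔸.sTotal_isHom _).map_zero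
    map_one := mk_eq_of_forall fun _ => (𝔸.sTotal_isHom _).map_one }
  c_quantifier J := {
    map_zero := mk_eq_of_forall fun _ => (𝔸.c_quantifier _).map_zero
    le_apply := ind fun _ _ => mk_eq_of_forall fun _ => (𝔸.c_quantifier _).le_apply _
    odot_apply := ind fun _ _ => ind fun _ _ =>
      mk_eq_of_forall fun _ => (𝔸.c_quantifier _).odot_apply _ _
    oplus_apply := ind fun _ _ => ind fun _ _ =>
      mk_eq_of_forall fun _ => (𝔸.c_quantifier _).oplus_apply _ _
    odot_self := ind fun _ _ => mk_eq_of_forall fun _ => (𝔸.c_quantifier _).odot_self _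
    oplus_self := ind fun _ _ => mk_eq_of_forall fun _ => (𝔸.c_quantifier _).oplus_self _ }
  s_id h := ind fun f hf => mk_eq_of_forall fun n => by
    rw [L.conj_one, 𝔸.sTotal_of_mem L.rich.one_mem, 𝔸.s_id]
  s_comp τ τ' := ind fun f hf => mk_eq_mk.2 <| by
    filter_upwards [eventually_good τ, eventually_good τ'] with n h h'
    have hc : L.conj n (τ * τ' : L.semigroup).1 = L.conj n τ.1 * L.conj n τ'.1 := h'.conj_mul
    rw [hc, 𝔸.sTotal_of_mem h.mem, 𝔸.sTotal_of_mem h'.mem,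
      𝔸.sTotal_of_mem (G.mul_mem h.mem h'.mem), ← 𝔸.s_comp]
    rfl
  c_empty := ind fun f hf => mk_eq_of_forall fun n => by
    rw [Finset.image_empty, 𝔸.c_empty]
  c_union J J' := ind fun f hf => mk_eq_of_forall fun n => by
    rw [Finset.image_union, 𝔸.c_union]
  s_c_congr τ τ' J hJ := ind fun f hf => mk_eq_mk.2 <| by
    filter_upwards [eventually_good τ, eventually_good τ'] with n h h'
    rw [𝔸.sTotal_of_mem h.mem, 𝔸.sTotal_of_mem h'.mem]
    refine 𝔸.s_c_congr _ _ _ (fun i hi => ?_) _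
    change L.conj n τ.1 i = L.conj n τ'.1 i
    by_cases hi' : i ∈ L.levels n
    · obtain ⟨b, hb, rfl⟩ := hi'
      rw [L.conj_lev hb, L.conj_lev hb, hJ b fun hb => hi (Finset.mem_image_of_mem _ hb)]
    · rw [L.conj_of_notMem hi', L.conj_of_notMem hi']
  c_s τ J K hK hinj := ind fun f hf => mk_eq_mk.2 <| by
    filter_upwards [eventually_good τ, L.eventually_forall_rank_le J,
      L.eventually_forall_rank_le K] with n h hJ' hK'
    rw [𝔸.sTotal_of_mem h.mem]
    exact h.c_s hJ' hK' (Set.ext_iff.1 hK) (fun a ha b hb hab => hinj ha hb hab) _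

variable {L 𝔸}

theorem dilation_c_singleton_eq_iff {f : ℕ → A} (hf : L.IsThread 𝔸 f) (b : β) :
    (L.dilation 𝔸).c {b} (Dilation.mk f hf) = Dilation.mk f hf ↔
      ∀ᶠ n in atTop, 𝔸.c {L.lev n b} (f n) = f n := by
  classical
  refine mk_eq_mk.trans (eventually_congr (.of_forall fun n => ?_))
  rw [Finset.image_singleton]

/-- With `S = 𝔸.Sg X` this bounds the subalgebra of the dilation generated by the image of `X`. -/
theorem isSubuniverse_eventually_mem {S : Set A} (hS : 𝔸.IsSubuniverse S) :
    (L.dilation 𝔸).IsSubuniverse {x | ∃ f hf, x = Dilation.mk f hf ∧ ∀ᶠ n in atTop, f n ∈ S} where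
  oplus_mem := by
    rintro _ ⟨f, hf, rfl, h⟩ _ ⟨g, hg, rfl, h'⟩
    refine ⟨_, hf.oplus hg, rfl, ?_⟩
    filter_upwards [h, h'] with n h h' using hS.oplus_mem _ h _ h'
  odot_mem := by
    rintro _ ⟨f, hf, rfl, h⟩ _ ⟨g, hg, rfl, h'⟩
    refine ⟨_, hf.odot hg, rfl, ?_⟩
    filter_upwards [h, h'] with n h h' using hS.odot_mem _ h _ h'
  neg_mem := by
    rintro _ ⟨f, hf, rfl, h⟩
    exact ⟨_, hf.neg, rfl, h.mono fun n => hS.neg_mem _⟩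
  zero_mem := ⟨_, .zero, rfl, .of_forall fun _ => hS.zero_mem⟩
  one_mem := ⟨_, .one, rfl, .of_forall fun _ => hS.one_mem⟩
  s_mem := by
    rintro τ _ ⟨f, hf, rfl, h⟩
    exact ⟨_, hf.s τ, rfl, h.mono fun n => hS.sTotal_mem _⟩
  c_mem := by
    rintro J _ ⟨f, hf, rfl, h⟩
    exact ⟨_, hf.c J, rfl, h.mono fun n => hS.c_mem _ _⟩

theorem IsThread.eventually_eq_iterate {f : ℕ → A} (hf : L.IsThread 𝔸 f) :
    ∀ᶠ n in atTop, (∀ k, f (n + k) = (𝔸.s L.shift)^[k] (f n)) ∧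
      ∀ i, i ∉ L.levels n → 𝔸.c {i} (f n) = f n := by
  obtain ⟨N, hN⟩ := eventually_atTop.1 hf
  filter_upwards [eventually_ge_atTop N] with n hn
  refine ⟨fun k => ?_, (hN n hn).2⟩
  induction k with
  | zero => rfl
  | succ k ih =>
    rw [Function.iterate_succ_apply', ← ih]
    exact (hN (n + k) (by omega)).1

theorem Dilation.countable [Countable A] : Countable (L.Dilation 𝔸) := by
  classical
  -- A class is determined by a late stage and the value there. Values before that stage are
  -- irrelevant, and pairs that yield no thread are sent to zero.
  let F : ℕ × A → L.Dilation 𝔸 := fun p =>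
    if h : L.IsThread 𝔸 fun n => (𝔸.s L.shift)^[n - p.1] p.2 then mk _ h else mk _ .zero
  refine Function.Surjective.countable (f := F) (ind fun f hf => ?_)
  obtain ⟨N, hN, -⟩ := hf.eventually_eq_iterate.exists
  have h : ∀ᶠ n in atTop, (𝔸.s L.shift)^[n - N] (f N) = f n := by
    filter_upwards [eventually_ge_atTop N] with n hn
    rw [← hN, Nat.add_sub_cancel' hn]
  have hf' : L.IsThread 𝔸 fun n => (𝔸.s L.shift)^[n - N] (f N) := by
    filter_upwards [h, (tendsto_add_atTop_nat 1).eventually h, hf] with n h h' hf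
    rwa [h, h']
  exact ⟨(N, f N), (dif_pos hf').trans (mk_eq_mk.2 h)⟩

variable (L 𝔸)

theorem c_singleton_iterate_shift (k : ℕ) (i : I) (p : A) :
    𝔸.c {L.σ^[k] i} ((𝔸.s L.shift)^[k] p) = (𝔸.s L.shift)^[k] (𝔸.c {i} p) := by
  rw [𝔸.iterate_s L.rich.one_mem, 𝔸.iterate_s L.rich.one_mem]
  refine 𝔸.c_s_of_iff (fun j => ?_) (fun _ _ _ _ h => L.σ_injective.iterate k h) p
  rw [Finset.mem_singleton, Finset.mem_singleton]
  exact (L.σ_injective.iterate k).eq_iff.symm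

variable {L 𝔸} in
theorem iterate_shift_unshift {n : ℕ} (hfin : (supp (L.σ^[n] ∘ L.π^[n])).Finite) {p : A}
    (hp : ∀ i, (∀ j, L.σ^[n] j ≠ i) → 𝔸.c {i} p = p) :
    (𝔸.s L.shift)^[n] ((𝔸.s L.unshift)^[n] p) = p := by
  -- Since `π ∘ σ = id`, the support of `σ^n ∘ π^n` avoids the range of `σ^n`. Thus `p` is fixed by
  -- the cylindrifier of that support, and modulo it `σ^n ∘ π^n` acts as the identity.
  have hsupp : ∀ i j, L.σ^[n] j = i → L.σ^[n] (L.π^[n] i) = i := by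
    rintro _ j rfl
    exact congrArg _ (L.rich.leftInverse.iterate n j)
  have hc : 𝔸.c hfin.toFinset p = p := 𝔸.c_eq_self fun i hi => hp i fun j hj =>
    (hfin.mem_toFinset.1 hi) (hsupp i j hj)
  rw [𝔸.iterate_s L.rich.one_mem, 𝔸.iterate_s L.rich.one_mem, ← 𝔸.s_comp, ← hc,
    𝔸.s_c_congr _ ⟨1, L.rich.one_mem⟩ hfin.toFinset, 𝔸.s_id]
  intro i hi
  by_contra h
  exact hi (hfin.mem_toFinset.2 h)

end Ladder

end MVPolyadic

/-! ### The embedding of 𝔸 and the neat reducts -/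

namespace MVPolyadic

open MVAlgebra Filter

namespace Ladder

variable {β : Type v} {α : Set β} {G : Subsemigroup (Function.End α)}

/-- The ladder `L` starts with the inclusion of `α` in `β`. -/
structure StartsAt (L : Ladder G β) : Prop where
  rank_eq_zero : ∀ b, L.rank b = 0 ↔ b ∈ α
  lev_zero : ∀ i : α, L.lev 0 i = i

namespace StartsAt

variable {L : Ladder G β} (hL : L.StartsAt)
include hL

theorem rank_coe (i : α) : L.rank i = 0 := (hL.rank_eq_zero i).2 i.2

theorem rank_coe_le (i : α) (n : ℕ) : L.rank i ≤ n := (hL.rank_coe i).trans_le n.zero_le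

theorem lev_coe (n : ℕ) (i : α) : L.lev n i = L.σ^[n] i := by
  have h := L.lev_add (hL.rank_coe_le i 0) n
  rw [hL.lev_zero] at h
  rwa [Nat.zero_add] at h

theorem iterate_mem_levels (n : ℕ) (i : α) : L.σ^[n] i ∈ L.levels n :=
  ⟨i, hL.rank_coe_le i n, hL.lev_coe n i⟩

theorem lev_ne_iterate {n : ℕ} {b : β} (hb : b ∉ α) (hn : L.rank b ≤ n) (i : α) :
    L.σ^[n] i ≠ L.lev n b := by
  intro h
  have := L.lev_inj n i b (hL.rank_coe_le i n) hn ((hL.lev_coe n i).trans h)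
  exact hb (this ▸ i.2)

theorem conj_extendId_lev (n : ℕ) (τ : Function.End α) (i : α) :
    L.conj n (extendId τ) (L.σ^[n] i) = L.σ^[n] (τ i) := by
  have h := L.conj_lev (hL.rank_coe_le i n) (extendId τ)
  rw [extendId_of_mem τ i.2] at h
  exact ((congrArg _ (hL.lev_coe n i)).symm.trans h).trans (hL.lev_coe n (τ i))

theorem good_extendId {τ : Function.End α} (hτ : τ ∈ G) : L.Good 0 (extendId τ) where
  rank_le b hb := by
    have hb' : b ∈ α := (hL.rank_eq_zero b).1 (Nat.le_zero.1 hb)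
    rw [extendId_of_mem τ hb']
    exact hL.rank_coe_le _ 0
  eq_self b hb := extendId_of_notMem τ fun h => hb.ne' ((hL.rank_eq_zero b).2 h)
  mem := by
    convert hτ using 1
    exact funext (hL.conj_extendId_lev 0 τ)

theorem extendId_mem (τ : Function.End α) (hτ : τ ∈ G) : extendId τ ∈ L.semigroup :=
  ⟨0, hL.good_extendId hτ⟩

theorem isStronglyRich (hfin : ∀ n : ℕ, (supp (L.σ^[n] ∘ L.π^[n])).Finite) :
    IsStronglyRich L.semigroup := by
  have hinv : Function.LeftInverse (extendId (β := β) L.π) (extendId L.σ) := by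
    have h : L.π * L.σ = 1 := L.rich.comp_eq_id
    intro b
    have h' := extendId_mul (β := β) L.π L.σ
    rw [h, extendId_one] at h'
    exact (congrFun h' b).symm
  have hsupp : ∀ n : ℕ, (supp ((extendId (β := β) L.σ)^[n] ∘ (extendId L.π)^[n])).Finite := by
    intro n
    rw [extendId_iterate, extendId_iterate]
    have h := extendId_mul (β := β) (L.σ^[n] : Function.End α) (L.π^[n] : Function.End α)
    have h' := (congrArg supp h).symm.trans (supp_extendId _)
    exact ((hfin n).image Subtype.val).subset h'.subset
  have hrange : ∀ n : ℕ, supp ((extendId (β := β) L.σ)^[n] ∘ (extendId L.π)^[n]) ⊆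
      (Set.range (extendId (β := β) L.σ)^[n])ᶜ := by
    rintro n _ hb ⟨b, rfl⟩
    exact hb (congrArg _ (hinv.iterate n b))
  refine ⟨L.semigroup_closed, extendId L.σ, extendId L.π,
    ⟨hL.extendId_mem _ L.rich.left_mem, hL.extendId_mem _ L.rich.right_mem, funext hinv, ?_, ?_⟩,
    hsupp, hrange⟩
  · obtain ⟨d, hd⟩ := (Set.ne_univ_iff_exists_notMem _).1 L.rich.range_ne
    refine (Set.ne_univ_iff_exists_notMem _).2 ⟨d, ?_⟩
    rintro ⟨b, hb⟩
    have hb' : b ∈ α := by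
      by_contra h
      rw [extendId_of_notMem _ h] at hb
      exact h (hb ▸ d.2)
    rw [extendId_of_mem _ hb'] at hb
    exact hd ⟨_, Subtype.ext hb⟩
  · intro τ hτ
    -- The complement of the range of `extendId σ` lies in the support of `extendId σ ∘ extendId π`,
    -- hence is finite; so the patch is a finite replacement.
    refine L.semigroup_closed.patch_mem (L.semigroup.mul_mem (L.semigroup.mul_mem
      (hL.extendId_mem _ L.rich.left_mem) hτ) (hL.extendId_mem _ L.rich.right_mem)) ?_ _
    refine (hsupp 1).subset fun b hb h => hb ⟨extendId L.π b, h⟩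

variable {A : Type u} [MVAlgebra A] (𝔸 : PolyadicMV G A)

theorem isThread_iterate (a : A) : L.IsThread 𝔸 fun n => (𝔸.s L.shift)^[n] a := by
  refine .of_forall fun n => ⟨Function.iterate_succ_apply' _ _ _, fun i hi => ?_⟩
  simp only [𝔸.iterate_s L.rich.one_mem]
  refine 𝔸.c_s_of_notMem_range (fun k hk => ?_) a
  rw [← hk] at hi
  exact hi (hL.iterate_mem_levels n k)

/-- The canonical embedding in the dilation. -/
def embed (a : A) : L.Dilation 𝔸 := Dilation.mk _ (hL.isThread_iterate 𝔸 a)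

theorem embed_injective : Function.Injective (hL.embed 𝔸) := by
  intro a b h
  obtain ⟨n, hn⟩ := (Dilation.mk_eq_mk.1 h).exists
  exact (L.s_shift_leftInverse 𝔸).injective.iterate n hn

theorem embed_isHom :
    𝔸.IsHom ((L.dilation 𝔸).reduct hL.extendId_mem) (hL.embed 𝔸) where
  map_oplus a b := Dilation.mk_eq_of_forall fun n => by
    induction n with
    | zero => rfl
    | succ n ih => simp only [Function.iterate_succ_apply', ih, (𝔸.s_isHom _).map_oplus]
  map_odot a b := Dilation.mk_eq_of_forall fun n => by
    induction n with
    | zero => rfl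
    | succ n ih => simp only [Function.iterate_succ_apply', ih, (𝔸.s_isHom _).map_odot]
  map_neg a := Dilation.mk_eq_of_forall fun n => by
    induction n with
    | zero => rfl
    | succ n ih => simp only [Function.iterate_succ_apply', ih, (𝔸.s_isHom _).map_neg]
  map_zero := Dilation.mk_eq_of_forall fun n =>
    Function.iterate_fixed (𝔸.s_isHom _).map_zero n
  map_one := Dilation.mk_eq_of_forall fun n =>
    Function.iterate_fixed (𝔸.s_isHom _).map_one n
  map_s τ a := Dilation.mk_eq_of_forall fun n => by
    have h := ((hL.good_extendId τ.2).mono n.zero_le).mem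
    rw [𝔸.sTotal_of_mem h]
    simp only [𝔸.iterate_s L.rich.one_mem, ← 𝔸.s_comp]
    refine congrArg (fun ρ => 𝔸.s ρ a) (Subtype.ext (funext fun i => ?_))
    exact (hL.conj_extendId_lev n τ.1 i).symm
  map_c J a := Dilation.mk_eq_of_forall fun n => by
    classical
    simp only [𝔸.iterate_s L.rich.one_mem]
    refine (𝔸.c_image_s (L.σ_injective.iterate n) J a).symm.trans ?_
    refine congrArg (fun K => 𝔸.c K _) ?_
    ext i
    simp only [Finset.mem_image, Finset.mem_map]
    constructor
    · rintro ⟨j, hj, rfl⟩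
      exact ⟨j, ⟨j, hj, rfl⟩, hL.lev_coe n j⟩
    · rintro ⟨_, ⟨j, hj, rfl⟩, rfl⟩
      exact ⟨j, hj, (hL.lev_coe n j).symm⟩

/-- From its rank on, an element of β ∖ α is represented outside the range of `σ^n`, on which the
shifted `a` does not depend. -/
theorem embed_mem_Nr (a : A) : hL.embed 𝔸 a ∈ (L.dilation 𝔸).Nr α Set.univ := by
  refine PolyadicMV.mem_Nr.2 ⟨trivial, fun b hb => (dilation_c_singleton_eq_iff _ b).2 ?_⟩
  filter_upwards [L.eventually_rank_le b] with n hn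
  rw [𝔸.iterate_s L.rich.one_mem]
  exact 𝔸.c_s_of_notMem_range (fun k => hL.lev_ne_iterate hb hn k) a

variable {𝔸}

theorem eq_embed (hfin : ∀ n : ℕ, (supp (L.σ^[n] ∘ L.π^[n])).Finite) {S : Set A}
    (hS : 𝔸.IsSubuniverse S) {f : ℕ → A} (hf : L.IsThread 𝔸 f) (hfS : ∀ᶠ n in atTop, f n ∈ S)
    (hc : ∀ b, b ∉ α → (L.dilation 𝔸).c {b} (Dilation.mk f hf) = Dilation.mk f hf) :
    ∃ a ∈ S, hL.embed 𝔸 a = Dilation.mk f hf := by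
  obtain ⟨N, ⟨hN, hlev⟩, hNS⟩ := (hf.eventually_eq_iterate.and hfS).exists
  have hfix : ∀ i, (∀ j, L.σ^[N] j ≠ i) → 𝔸.c {i} (f N) = f N := by
    intro i hi
    by_cases hi' : i ∈ L.levels N
    · obtain ⟨b, hb, rfl⟩ := hi'
      have hbα : b ∉ α := fun h => hi ⟨b, h⟩ (hL.lev_coe N ⟨b, h⟩).symm
      -- Independence of `b` is known only at late stages `N + k`; there it is the `k`-fold shift of
      -- the equation at stage `N`, and the shift is injective.
      obtain ⟨n, hn, hNn⟩ := (((dilation_c_singleton_eq_iff hf b).1 (hc b hbα)).and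
        (eventually_ge_atTop N)).exists
      obtain ⟨k, rfl⟩ := Nat.exists_eq_add_of_le hNn
      rw [hN k, L.lev_add hb, L.c_singleton_iterate_shift] at hn
      exact (L.s_shift_leftInverse 𝔸).injective.iterate k hn
    · exact hlev i hi'
  have h := iterate_shift_unshift (hfin N) hfix
  -- The preimage is `(s π)^N (f N)`; its `N`-fold shift is `f N` again.
  refine ⟨_, hS.iterate_mem L.unshift N hNS, Dilation.mk_eq_mk.2 ?_⟩
  filter_upwards [eventually_ge_atTop N] with n hn
  obtain ⟨k, rfl⟩ := Nat.exists_eq_add_of_le' hn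
  rw [Function.iterate_add_apply, h, Nat.add_comm, hN]

theorem image_Sg (hfin : ∀ n : ℕ, (supp (L.σ^[n] ∘ L.π^[n])).Finite) (X : Set A) :
    hL.embed 𝔸 '' 𝔸.Sg X = (L.dilation 𝔸).Nr α ((L.dilation 𝔸).Sg (hL.embed 𝔸 '' X)) := by
  have he := hL.embed_isHom 𝔸
  apply Set.Subset.antisymm
  · rintro _ ⟨a, ha, rfl⟩
    refine ⟨?_, (hL.embed_mem_Nr 𝔸 a).2⟩
    have hB := (L.dilation 𝔸).Sg_isSubuniverse (hL.embed 𝔸 '' X)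
    refine 𝔸.Sg_subset (S := hL.embed 𝔸 ⁻¹' (L.dilation 𝔸).Sg (hL.embed 𝔸 '' X)) ?_
      (fun x hx => (L.dilation 𝔸).subset_Sg _ (Set.mem_image_of_mem _ hx)) ha
    constructor <;> simp only [Set.mem_preimage]
    · intro a ha b hb
      rw [he.map_oplus]
      exact hB.oplus_mem _ ha _ hb
    · intro a ha b hb
      rw [he.map_odot]
      exact hB.odot_mem _ ha _ hb
    · intro a ha
      rw [he.map_neg]
      exact hB.neg_mem _ ha
    · rw [he.map_zero]
      exact hB.zero_mem
    · rw [he.map_one]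
      exact hB.one_mem
    · intro τ a ha
      rw [he.map_s]
      exact hB.s_mem _ _ ha
    · intro J a ha
      rw [he.map_c]
      exact hB.c_mem _ _ ha
  · intro x hx
    obtain ⟨hx, hxα⟩ := PolyadicMV.mem_Nr.1 hx
    have hS := 𝔸.Sg_isSubuniverse X
    have hX : hL.embed 𝔸 '' X ⊆
        {x | ∃ f hf, x = (Dilation.mk f hf : L.Dilation 𝔸) ∧ ∀ᶠ n in atTop, f n ∈ 𝔸.Sg X} := by
      rintro _ ⟨a, ha, rfl⟩
      exact ⟨_, hL.isThread_iterate 𝔸 a, rfl,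
        .of_forall fun n => hS.iterate_mem _ _ (𝔸.subset_Sg X ha)⟩
    obtain ⟨f, hf, rfl, hfS⟩ :=
      PolyadicMV.Sg_subset _ (isSubuniverse_eventually_mem hS) hX hx
    exact hL.eq_embed hfin hS hf hfS hxα

end StartsAt

open Classical in
/-- A ladder for a countable superset of `α`. The `k`-th new index, in some enumeration,
is the fixed index `d` of stage `k + 1`. -/
theorem exists_startsAt [Countable β] {σ π : Function.End α} (rich : IsRichPair G σ π)
    (closed : ClosedUnderReplacement G) :
    ∃ L : Ladder G β, L.σ = σ ∧ L.π = π ∧ L.StartsAt := by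
  obtain ⟨d, hd⟩ := (Set.ne_univ_iff_exists_notMem _).1 rich.range_ne
  -- A point born outside the range of `σ` never coincides with anything that has been shifted more
  -- often. All injectivity of the levels rests on this.
  have hd' : ∀ m n : ℕ, m < n → ∀ i, σ^[m] d ≠ σ^[n] i := by
    intro m n hmn i h
    obtain ⟨k, rfl⟩ := Nat.exists_eq_add_of_lt hmn
    rw [Nat.add_assoc] at h
    have h' := h.trans (Function.iterate_add_apply σ m (k + 1) i)
    have h'' := rich.leftInverse.injective.iterate m h'
    exact hd ⟨σ^[k] i, (h''.trans (Function.iterate_succ_apply' σ k i)).symm⟩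
  obtain ⟨c, hc⟩ := exists_injective_nat β
  -- Rank 0 is reserved for α, so that a new index has always been shifted fewer times than those of
  -- α. Injectivity of `c` separates the new indices; below the rank the truncated subtraction
  -- yields a value of no significance.
  let rank : β → ℕ := fun b => if b ∈ α then 0 else c b + 1
  let lev : ℕ → β → α := fun n b => if h : b ∈ α then σ^[n] ⟨b, h⟩ else σ^[n - (c b + 1)] d
  have rank_mem : ∀ b, b ∈ α → rank b = 0 := fun b h => if_pos h
  have rank_notMem : ∀ b, b ∉ α → rank b = c b + 1 := fun b h => if_neg h
  have lev_mem : ∀ n b (h : b ∈ α), lev n b = σ^[n] ⟨b, h⟩ := fun n b h => dif_pos h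
  have lev_notMem : ∀ n b, b ∉ α → lev n b = σ^[n - (c b + 1)] d := fun n b h => dif_neg h
  have lev_ne : ∀ n a b, a ∈ α → b ∉ α → rank b ≤ n → lev n a ≠ lev n b := by
    intro n a b ha hb hn h
    rw [lev_mem n a ha, lev_notMem n b hb] at h
    rw [rank_notMem b hb] at hn
    exact hd' _ _ (by omega) _ h.symm
  have lev_ne' : ∀ n a b, a ∉ α → b ∉ α → rank b ≤ n → c a < c b → lev n a ≠ lev n b := by
    intro n a b ha hb hn hab h
    rw [lev_notMem n a ha, lev_notMem n b hb] at h
    rw [rank_notMem b hb] at hn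
    exact hd' _ _ (by omega) _ h.symm
  refine ⟨⟨σ, π, rich, closed, rank, lev, fun n b hn => ?_, fun n a b ha hb h => ?_⟩, rfl, rfl,
    fun b => ⟨fun h => ?_, rank_mem b⟩, fun i => lev_mem 0 i i.2⟩
  · by_cases hb : b ∈ α
    · rw [lev_mem _ b hb, lev_mem _ b hb]
      exact Function.iterate_succ_apply' σ n _
    · rw [lev_notMem _ b hb, lev_notMem _ b hb]
      rw [rank_notMem b hb] at hn
      rw [Nat.succ_sub hn]
      exact Function.iterate_succ_apply' σ _ _
  · by_cases haα : a ∈ α <;> by_cases hbα : b ∈ α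
    · rw [lev_mem _ a haα, lev_mem _ b hbα] at h
      exact congrArg Subtype.val (rich.leftInverse.injective.iterate n h)
    · exact absurd h (lev_ne n a b haα hbα hb)
    · exact absurd h.symm (lev_ne n b a hbα haα ha)
    · rcases Nat.lt_trichotomy (c a) (c b) with h' | h' | h'
      · exact absurd h (lev_ne' n a b haα hbα hb h')
      · exact hc h'
      · exact absurd h.symm (lev_ne' n b a hbα haα ha h')
  · by_contra hb
    exact absurd ((rank_notMem b hb).symm.trans h) (Nat.succ_ne_zero _)

end Ladder

end MVPolyadic

theorem mainTheorem11 {β : Type v} [Countable β] (α : Set β) (hα : α.Infinite)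
    (G : Subsemigroup (Function.End α)) (hG : MVPolyadic.IsStronglyRich G)
    {A : Type u} [MVPolyadic.MVAlgebra A] (𝔸 : MVPolyadic.PolyadicMV G A) :
    ∃ (H : Subsemigroup (Function.End β)) (hGH : ∀ τ ∈ G, MVPolyadic.extendId τ ∈ H)
      (B : Type u) (_ : MVPolyadic.MVAlgebra B) (𝔅 : MVPolyadic.PolyadicMV H B) (e : A → B),
      MVPolyadic.IsStronglyRich H ∧
      -- `Nr_α 𝔅` exists, and `e` is an embedding of `𝔸` into it
      (𝔅.reduct hGH).IsSubuniverse (𝔅.Nr α Set.univ) ∧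
      Function.Injective e ∧
      𝔸.IsHom (𝔅.reduct hGH) e ∧
      (∀ a, e a ∈ 𝔅.Nr α Set.univ) ∧
      -- `Sg^𝔸 X = Nr_α Sg^𝔅 X`
      (∀ X : Set A, e '' 𝔸.Sg X = 𝔅.Nr α (𝔅.Sg (e '' X))) ∧
      -- countable data have a countable dilation
      ((G : Set (Function.End α)).Countable → Countable A →
        (H : Set (Function.End β)).Countable ∧ Countable B) := by
  obtain ⟨hclosed, σ, π, hrich, hfin, -⟩ := hG
  obtain ⟨L, rfl, rfl, hL⟩ := MVPolyadic.Ladder.exists_startsAt hrich hclosed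
  exact ⟨L.semigroup, hL.extendId_mem, L.Dilation 𝔸, inferInstance, L.dilation 𝔸, hL.embed 𝔸,
    hL.isStronglyRich hfin, MVPolyadic.PolyadicMV.Nr_univ_isSubuniverse _ _,
    hL.embed_injective 𝔸, hL.embed_isHom 𝔸, hL.embed_mem_Nr 𝔸, hL.image_Sg hfin,
    fun hG _ => ⟨L.semigroup_countable hG, MVPolyadic.Ladder.Dilation.countable⟩⟩
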